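/- Let $k \ge 0$ and $m \ge 1$ be integers and let $y, z \in \mathbb{Z}_{\ge 0}^k$. For $1 \le i \le k$ put $\tilde y_i = y_1 + \cdots + y_i$ and $\tilde z_i = z_1 + \cdots + z_i$. Let the $m$-generalized Pitman--Stanley polytope $\operatorname{PS}_k^m(y,z) \subset \mathbb{R}^{km}$ be the set of all points $(x_{i,j})_{1 \le i \le k,\, 1 \le j \le m}$ such that $$\tilde z_i \le x_{i,1} \le x_{i,2} \le \cdots \le x_{i,m} \le \tilde y_i \quad (1 \le i \le k) \qquad\text{and}\qquad x_{i,j} \le x_{i+1,j} \quad (1 \le i < k,\ 1 \le j \le m).$$ Then $Q = \operatorname{PS}_k^m(y,z)$ is Ehrhart positive, that is: $Q$ is a lattice polytope (the convex hull of a finite, possibly empty, set of points of $\mathbb{Z}^{km}$), and there is a polynomial $E_Q \in \mathbb{Q}[t]$ (the Ehrhart polynomial of $Q$), all of whose coefficients are nonnegative, such that $|nQ \cap \mathbb{Z}^{km}| = E_Q(n)$ for every integer $n \ge 0$, where $nQ = \{nx : x \in Q\}$. -/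

import Mathlib

/-- The integer lattice `ℤ^ι` inside `ℝ^ι`. -/
def integerLattice (ι : Type*) : Set (ι → ℝ) :=
  {x | ∀ i, ∃ a : ℤ, x i = (a : ℝ)}

/-- A lattice polytope: the convex hull of a finite set of integer points.
The empty set is a lattice polytope. -/
def IsLatticePolytope {ι : Type*} (Q : Set (ι → ℝ)) : Prop :=
  ∃ V : Finset (ι → ℝ), (∀ v ∈ V, v ∈ integerLattice ι) ∧
    Q = convexHull ℝ (V : Set (ι → ℝ))

/-- The `n`-th dilate `nQ = {n x : x ∈ Q}`. -/
def dilate {ι : Type*} (n : ℕ) (Q : Set (ι → ℝ)) : Set (ι → ℝ) :=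
  (fun x : ι → ℝ => (n : ℝ) • x) '' Q

/-- `E` is the Ehrhart polynomial of `Q`: it counts the integer points of `nQ` for all `n ≥ 0`.
Since `E` is prescribed at infinitely many points, there is at most one such `E`. -/
def IsEhrhartPolynomial {ι : Type*} (Q : Set (ι → ℝ)) (E : Polynomial ℚ) : Prop :=
  ∀ n : ℕ, ((dilate n Q ∩ integerLattice ι).ncard : ℚ) = E.eval (n : ℚ)

/-- `Q` is Ehrhart positive: it is a lattice polytope and its Ehrhart polynomial has only
nonnegative coefficients. -/
def EhrhartPositive {ι : Type*} (Q : Set (ι → ℝ)) : Prop :=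
  IsLatticePolytope Q ∧
    ∃ E : Polynomial ℚ, IsEhrhartPolynomial Q E ∧ ∀ d : ℕ, 0 ≤ E.coeff d

/-- The partial sum `y_1 + ⋯ + y_i`. -/
def partialSum {k : ℕ} (y : Fin k → ℕ) (i : Fin k) : ℕ :=
  ∑ l ∈ Finset.Iic i, y l

/-- The `m`-generalized Pitman–Stanley polytope `PS_k^m(y, z)` for `m ≥ 1`. The first two
conditions are the chains `z̃_i ≤ x_{i,1} ≤ ⋯ ≤ x_{i,m} ≤ ỹ_i`, the third one is
`x_{i,j} ≤ x_{i+1,j}`. -/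
def pitmanStanley (k m : ℕ) (y z : Fin k → ℕ) : Set (Fin k × Fin m → ℝ) :=
  {x | (∀ i j, (partialSum z i : ℝ) ≤ x (i, j) ∧ x (i, j) ≤ (partialSum y i : ℝ)) ∧
    (∀ i, ∀ j j' : Fin m, (j : ℕ) + 1 = j' → x (i, j) ≤ x (i, j')) ∧
    (∀ i i' : Fin k, (i : ℕ) + 1 = i' → ∀ j, x (i, j) ≤ x (i', j))}

/-! Put P = `Fin k × Fin m`. The polytope consists of the monotone maps P → ℝ between two bounds
`lo` and `hi` that depend only on the row. It is a lattice polytope because such a map x is the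
mean, over θ in [0, 1), of the integral monotone maps ⌊x + θ⌋.

A lattice point x of nQ amounts to the chain of lower sets {x < t}. For t in a block nv, ..., n(v +
1) - 1 the bounds constrain this chain in the same way, so crossing a block contributes entries of ζ
^ n, where ζ is the zeta matrix of the lattice of lower sets of P (`card_truncatedMaps_add`). The
count is a sum of products of such entries, and it remains to see that each entry is a polynomial in
n with nonnegative coefficients (`exists_poly_eval_eq_zetaMatrix_pow`).

Polynomiality is Kreweras' determinant formula, proved through the recursion
`eval_add_one_krewerasPoly`. For positivity, Z(s + t) = Z(s) Z(t) yields Z' = Z'(0) Z, so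
coefficients 0 and 1 decide everything (`Matrix.coeff_nonneg_of_eval_eq_pow`). The determinant of a
disconnected skew shape factors; for a connected one the constant coefficient vanishes and the
linear one comes from a single matrix entry of known sign (`krewerasPoly_connected`). -/

open Polynomial

/-! ### Multiset coefficients as polynomials -/

/-- The polynomial `X (X + 1) ⋯ (X + d - 1) / d!`, which is zero for negative `d`. -/
noncomputable def multichoosePoly (d : ℤ) : ℚ[X] :=
  if d < 0 then 0 else
    C ((d.toNat.factorial : ℚ)⁻¹) * ∏ r ∈ Finset.range d.toNat, (X + C (r : ℚ))

lemma multichoosePoly_of_neg {d : ℤ} (h : d < 0) : multichoosePoly d = 0 := if_pos h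

lemma multichoosePoly_natCast (d : ℕ) :
    multichoosePoly d = C ((d.factorial : ℚ)⁻¹) * ∏ r ∈ Finset.range d, (X + C (r : ℚ)) := by
  simp [multichoosePoly]

lemma eval_multichoosePoly_natCast (d : ℕ) (x : ℚ) :
    (multichoosePoly d).eval x = (d.factorial : ℚ)⁻¹ * ∏ r ∈ Finset.range d, (x + r) := by
  simp [multichoosePoly_natCast, eval_prod]

lemma multichoosePoly_zero : multichoosePoly 0 = 1 := by
  simpa using multichoosePoly_natCast 0

lemma eval_add_one_multichoosePoly (d : ℤ) (x : ℚ) :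
    (multichoosePoly d).eval (x + 1) =
      (multichoosePoly d).eval x + (multichoosePoly (d - 1)).eval (x + 1) := by
  rcases lt_trichotomy d 0 with h | rfl | h
  · simp [multichoosePoly_of_neg h, multichoosePoly_of_neg (show d - 1 < 0 by omega)]
  · simp [multichoosePoly_zero, multichoosePoly_of_neg]
  · obtain ⟨e, rfl⟩ : ∃ e : ℕ, d = ((e + 1 : ℕ) : ℤ) := ⟨d.toNat - 1, by omega⟩
    have h1 : ((e + 1 : ℕ) : ℤ) - 1 = (e : ℕ) := by push_cast; ring
    rw [h1]
    simp only [eval_multichoosePoly_natCast]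
    rw [Finset.prod_range_succ, Finset.prod_range_succ' (fun r : ℕ => x + (r : ℚ)),
      Nat.factorial_succ]
    have h2 : ∀ r : ℕ, x + ((r + 1 : ℕ) : ℚ) = x + 1 + r := fun r => by push_cast; ring
    simp only [h2]
    have : (e.factorial : ℚ) ≠ 0 := by positivity
    push_cast
    field_simp
    ring

lemma eval_neg_multichoosePoly {d : ℤ} {p : ℕ} (h : (p : ℤ) < d) :
    (multichoosePoly d).eval (-(p : ℚ)) = 0 := by
  obtain ⟨e, rfl⟩ : ∃ e : ℕ, d = (e : ℤ) := ⟨d.toNat, by omega⟩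
  rw [eval_multichoosePoly_natCast, Finset.prod_eq_zero (i := p)]
  · simp
  · simp; omega
  · simp

lemma eval_one_multichoosePoly {d : ℤ} (h : 0 ≤ d) : (multichoosePoly d).eval 1 = 1 := by
  obtain ⟨e, rfl⟩ : ∃ e : ℕ, d = (e : ℤ) := ⟨d.toNat, by omega⟩
  induction e with
  | zero => simp [multichoosePoly_zero]
  | succ e ih =>
    have := eval_add_one_multichoosePoly ((e + 1 : ℕ) : ℤ) 0
    have h0 := eval_neg_multichoosePoly (d := ((e + 1 : ℕ) : ℤ)) (p := 0) (by push_cast; omega)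
    have h1 : ((e + 1 : ℕ) : ℤ) - 1 = (e : ℕ) := by push_cast; ring
    rw [h1] at this
    simp only [Nat.cast_zero, neg_zero] at h0
    rw [zero_add, h0, ih (by omega), zero_add] at this
    exact this

/-- Summation of the Pascal recursion. -/
lemma sum_Ico_eval_multichoosePoly {D a N : ℤ} (hD : D < N) (ha : a ≤ N) (x : ℚ) :
    ∑ c ∈ Finset.Ico a N, (multichoosePoly (D - c)).eval x =
      (multichoosePoly (D - a)).eval (x + 1) := by
  obtain ⟨n, rfl⟩ : ∃ n : ℕ, a = N - n := ⟨(N - a).toNat, by omega⟩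
  clear ha
  induction n with
  | zero => simp [multichoosePoly_of_neg (show D - N < 0 by omega)]
  | succ n ih =>
    have : Finset.Ico (N - ((n + 1 : ℕ) : ℤ)) N =
        insert (N - ((n + 1 : ℕ) : ℤ)) (Finset.Ico (N - (n : ℤ)) N) := by
      ext y; simp; omega
    rw [this, Finset.sum_insert (by simp only [Finset.mem_Ico]; omega), ih,
      eval_add_one_multichoosePoly (D - (N - ((n + 1 : ℕ) : ℤ))),
      show D - (N - ((n + 1 : ℕ) : ℤ)) - 1 = D - (N - n) by push_cast; ring]

/-- The linear coefficient of `multichoosePoly d` recentred at a root `-p` has sign `(-1)^p`. -/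
lemma coeff_one_multichoosePoly_comp {d : ℤ} {p : ℕ} (h : (p : ℤ) < d) :
    0 ≤ (-1) ^ p * ((multichoosePoly d).comp (X + C (-(p : ℚ)))).coeff 1 := by
  obtain ⟨e, rfl⟩ : ∃ e : ℕ, d = ((p + 1 + e : ℕ) : ℤ) := ⟨(d - p - 1).toNat, by push_cast; omega⟩
  -- After recentring, the factor r = p becomes X; the p factors before it have negative constant
  -- terms, the e factors after it positive ones.
  have key : (multichoosePoly ((p + 1 + e : ℕ) : ℤ)).comp (X + C (-(p : ℚ))) =
      X * (C (((p + 1 + e).factorial : ℚ)⁻¹) * (∏ r ∈ Finset.range p, (X + C ((r : ℚ) - p))) *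
        ∏ r ∈ Finset.range e, (X + C ((r : ℚ) + 1))) := by
    rw [multichoosePoly_natCast, Finset.prod_range_add, Finset.prod_range_succ]
    simp only [mul_comp, prod_comp, add_comp, X_comp, C_comp]
    have h1 : ∀ r : ℕ, (X + C (-(p : ℚ)) + C (r : ℚ) : ℚ[X]) = X + C ((r : ℚ) - p) := fun r => by
      rw [add_assoc, ← C_add]; congr 2; ring
    have h2 : ∀ r : ℕ, ((((p + 1 + r : ℕ) : ℚ)) - p : ℚ) = (r : ℚ) + 1 := fun r => by
      push_cast; ring
    simp only [h1, h2, sub_self, C_0, add_zero]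
    ring
  rw [key, show (1 : ℕ) = 0 + 1 from rfl, coeff_X_mul, coeff_zero_eq_eval_zero]
  simp only [eval_mul, eval_C, eval_prod, eval_add, eval_X, zero_add]
  have h3 : (-1 : ℚ) ^ p * ∏ r ∈ Finset.range p, ((r : ℚ) - p) =
      ∏ r ∈ Finset.range p, ((p : ℚ) - r) := by
    have : (-1 : ℚ) ^ p = ∏ _r ∈ Finset.range p, (-1 : ℚ) := by simp
    rw [this, ← Finset.prod_mul_distrib]
    exact Finset.prod_congr rfl fun r _ => by ring
  have h4 : 0 ≤ ∏ r ∈ Finset.range p, ((p : ℚ) - r) := Finset.prod_nonneg fun r hr => by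
    have : r < p := Finset.mem_range.1 hr
    have : (r : ℚ) < p := by exact_mod_cast this
    linarith
  have h5 : 0 ≤ ∏ r ∈ Finset.range e, ((r : ℚ) + 1) := Finset.prod_nonneg fun r _ => by positivity
  calc (0 : ℚ) ≤ ((p + 1 + e).factorial : ℚ)⁻¹ * (∏ r ∈ Finset.range p, ((p : ℚ) - r)) *
        ∏ r ∈ Finset.range e, ((r : ℚ) + 1) := by positivity
    _ = _ := by rw [← h3]; ring

/-! ### Cancellation in alternating maps -/

/-- If `G j a = ∑_{c > a} G (j + 1) c`, then in the multilinear expansion of an alternating map at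
the tail sums of `G` the terms with non-antitone index cancel. -/
lemma AlternatingMap.map_sum_Ico_eq_sum_antitone {k : ℕ} {M : Type*} [AddCommGroup M] [Module ℚ M]
    (F : M [⋀^Fin k]→ₗ[ℚ] ℚ) (G : Fin k → ℤ → M) (μ : Fin k → ℤ) (hμ : Antitone μ) (N : ℤ)
    (hG : ∀ j j' : Fin k, (j : ℕ) + 1 = j' → ∀ a < N, G j a = ∑ c ∈ Finset.Ioo a N, G j' c) :
    F (fun j => ∑ a ∈ Finset.Ico (μ j) N, G j a) =
      ∑ ν ∈ Fintype.piFinset (fun j => Finset.Ico (μ j) N) with Antitone ν,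
        F (fun j => G j (ν j)) := by
  classical
  set Ω := Fintype.piFinset (fun j => Finset.Ico (μ j) N) with hΩ
  -- Antitone on the indices 0, ..., r. Non-antitone terms are removed one adjacent pair of indices
  -- at a time.
  let pre : ℕ → (Fin k → ℤ) → Prop := fun r ν => ∀ i j : Fin k, i ≤ j → (j : ℕ) ≤ r → ν j ≤ ν i
  have h0 : F (fun j => ∑ a ∈ Finset.Ico (μ j) N, G j a) =
      ∑ ν ∈ Ω with pre 0 ν, F (fun j => G j (ν j)) := by
    rw [Finset.filter_true_of_mem]
    · exact F.toMultilinearMap.map_sum_finset G _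
    · intro ν _ i j hij hj
      have : i = j := Fin.ext (by have := Fin.le_def.1 hij; omega)
      rw [this]
  have hk : ∑ ν ∈ Ω with pre k ν, F (fun j => G j (ν j)) =
      ∑ ν ∈ Ω with Antitone ν, F (fun j => G j (ν j)) := by
    congr 1
    refine Finset.filter_congr fun ν _ => ?_
    exact ⟨fun h i j hij => h i j hij j.2.le, fun h i j hij _ => h hij⟩
  have hstep : ∀ r, ∑ ν ∈ Ω with pre r ν, F (fun j => G j (ν j)) =
      ∑ ν ∈ Ω with pre (r + 1) ν, F (fun j => G j (ν j)) := by
    intro r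
    by_cases hr : r + 1 < k
    swap
    · congr 1
      refine Finset.filter_congr fun ν _ => ?_
      exact ⟨fun h i j hij _ => h i j hij (by omega), fun h i j hij _ => h i j hij (by omega)⟩
    let p : Fin k := ⟨r, by omega⟩
    let q : Fin k := ⟨r + 1, hr⟩
    have hpq : p ≠ q := by simp [p, q]
    rw [← Finset.sum_filter_add_sum_filter_not (Ω.filter (pre r)) (fun ν => ν q ≤ ν p)]
    have h1 : (Ω.filter (pre r)).filter (fun ν => ν q ≤ ν p) = Ω.filter (pre (r + 1)) := by
      rw [Finset.filter_filter]
      refine Finset.filter_congr fun ν _ => ⟨?_, ?_⟩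
      · rintro ⟨h, hqp⟩ i j hij hj
        rcases Nat.lt_or_ge r j with hj' | hj'
        · have hjq : j = q := Fin.ext (by simp [q]; omega)
          rcases eq_or_lt_of_le hij with rfl | hij'
          · exact le_rfl
          · subst hjq
            refine hqp.trans (h i p ?_ le_rfl)
            have := Fin.lt_def.1 hij'
            simp only [q] at this
            exact Fin.le_def.2 (by simp [p]; omega)
        · exact h i j hij hj'
      · intro h
        exact ⟨fun i j hij hj => h i j hij (by omega),
          h p q (Fin.le_def.2 (by simp [p, q])) le_rfl⟩
    rw [h1, add_eq_left]
    set W := (Ω.filter (pre r)).filter (fun ν => ¬ ν q ≤ ν p) with hW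
    have hWmem : ∀ ν, ν ∈ W ↔ ((∀ j, μ j ≤ ν j ∧ ν j < N) ∧ pre r ν) ∧ ν p < ν q := by
      intro ν
      simp [hW, hΩ]
    -- On a violation ν p < ν q, argument p is expanded into the q-th family, so that arguments p
    -- and q come from the same family.
    have h2 : ∀ ν ∈ W, F (fun j => G j (ν j)) =
        ∑ c ∈ Finset.Ioo (ν p) N, F (Function.update (fun j => G j (ν j)) p (G q c)) := by
      intro ν hν
      have : (fun j => G j (ν j)) = Function.update (fun j => G j (ν j)) p
          (∑ c ∈ Finset.Ioo (ν p) N, G q c) := by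
        rw [← hG p q rfl (ν p) (((hWmem ν).1 hν).1.1 p).2]
        exact (Function.update_eq_self p (fun j => G j (ν j))).symm
      conv_lhs => rw [this]
      exact F.toMultilinearMap.map_update_sum _ _ _ _
    rw [Finset.sum_congr rfl h2, Finset.sum_sigma']
    have hneg : ∀ (ν : Fin k → ℤ) (c : ℤ),
        F (Function.update (fun j => G j (Function.update ν q c j)) p (G q (ν q))) =
          - F (Function.update (fun j => G j (ν j)) p (G q c)) := by
      intro ν c
      rw [← F.map_swap _ hpq]
      congr 1
      funext j
      by_cases hjp : j = p
      · subst hjp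
        simp [hpq.symm]
      · by_cases hjq : j = q
        · subst hjq
          simp [hpq.symm]
        · simp [Equiv.swap_apply_of_ne_of_ne hjp hjq, hjp, hjq]
    -- Exchanging c with ν q swaps two arguments of F, hence the sign. Both exceed ν p, so the
    -- violation persists, and c ≥ μ q because μ is antitone.
    refine Finset.sum_involution
      (fun x _ => ⟨Function.update x.1 q x.2, x.1 q⟩) ?_ ?_ ?_ ?_
    · rintro ⟨ν, c⟩ _
      simp only
      rw [hneg, add_neg_cancel]
    · rintro ⟨ν, c⟩ _ hne heq
      apply hne
      simp only [Sigma.mk.injEq, heq_eq_eq] at heq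
      have h3 := hneg ν c
      rw [heq.1, heq.2] at h3
      simp only
      linarith
    · rintro ⟨ν, c⟩ hx
      simp only [Finset.mem_sigma, hWmem, Finset.mem_Ioo] at hx ⊢
      obtain ⟨⟨⟨hb, hpre⟩, hlt⟩, hc⟩ := hx
      have hp : Function.update ν q c p = ν p := by simp [hpq]
      refine ⟨⟨⟨fun j => ?_, ?_⟩, ?_⟩, ?_⟩
      · by_cases hjq : j = q
        · subst hjq
          simp only [Function.update_self]
          exact ⟨(hμ (Fin.le_def.2 (by simp [p, q]))).trans ((hb p).1.trans hc.1.le), hc.2⟩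
        · simpa [hjq] using hb j
      · intro i j hij hj
        have hjq : j ≠ q := by rintro rfl; simp [q] at hj
        have hiq : i ≠ q := by
          rintro rfl
          have := Fin.le_def.1 hij
          simp [q] at this
          omega
        simpa [hjq, hiq] using hpre i j hij hj
      · simpa [hpq] using hc.1
      · rw [hp]
        exact ⟨hlt, (hb q).2⟩
    · rintro ⟨ν, c⟩ _
      simp
  rw [h0, ← hk]
  have : ∀ r, ∑ ν ∈ Ω with pre 0 ν, F (fun j => G j (ν j)) =
      ∑ ν ∈ Ω with pre r ν, F (fun j => G j (ν j)) := by
    intro r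
    induction r with
    | zero => rfl
    | succ r ih => rw [ih, hstep]
  exact this k

/-! ### Kreweras' determinant -/

/-- Kreweras' matrix of polynomials for the skew shape with row ends `l` and row starts `μ`. -/
noncomputable def krewerasMatrix {k : ℕ} (l μ : Fin k → ℤ) : Matrix (Fin k) (Fin k) ℚ[X] :=
  Matrix.of fun i j => (multichoosePoly (l i - μ j + j - i)).comp (X + C ((i : ℚ) - j))

/-- Kreweras' determinant of the skew shape with row ends `l` and row starts `μ`. -/
noncomputable def krewerasPoly {k : ℕ} (l μ : Fin k → ℤ) : ℚ[X] := (krewerasMatrix l μ).det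

lemma eval_krewerasPoly {k : ℕ} (l μ : Fin k → ℤ) (x : ℚ) :
    (krewerasPoly l μ).eval x = (Matrix.of fun i j : Fin k =>
      (multichoosePoly (l i - μ j + j - i)).eval (x + (i - j))).det := by
  rw [krewerasPoly, ← coe_evalRingHom, RingHom.map_det]
  congr 1
  ext i j
  simp [krewerasMatrix]

lemma krewerasMatrix_eq_zero {k : ℕ} {l μ : Fin k → ℤ} {i j : Fin k}
    (h : l i < μ j + (i - j)) : krewerasMatrix l μ i j = 0 := by
  rw [krewerasMatrix, Matrix.of_apply, multichoosePoly_of_neg (by omega), zero_comp]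

/-- If l r < μ r, all entries in rows ≥ r and columns ≤ r have negative degree index. The matrix is
block triangular and one diagonal block has a zero row. -/
lemma krewerasPoly_of_not_le {k : ℕ} {l μ : Fin k → ℤ} (hl : Antitone l) (hμ : Antitone μ)
    (h : ¬ μ ≤ l) : krewerasPoly l μ = 0 := by
  obtain ⟨r, hr⟩ : ∃ r, l r < μ r := by simpa [Pi.le_def] using h
  have key : ∀ i j : Fin k, r ≤ i → j ≤ r → krewerasMatrix l μ i j = 0 := fun i j hi hj =>
    krewerasMatrix_eq_zero (by
      have := hl hi
      have := hμ hj
      have := Fin.le_def.1 (hj.trans hi)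
      omega)
  rw [krewerasPoly, Matrix.twoBlockTriangular_det _ (fun i => i ≤ r)
    (fun i hi j hj => key i j (not_le.1 hi).le hj)]
  have : ((krewerasMatrix l μ).toSquareBlockProp fun i => i ≤ r).det = 0 :=
    Matrix.det_eq_zero_of_row_eq_zero ⟨r, le_rfl⟩ fun j => key r j le_rfl j.prop
  rw [this, zero_mul]

/-- At 1 the entries above the diagonal are evaluated at roots, and those on the diagonal equal 1.
-/
lemma eval_one_krewerasPoly {k : ℕ} {l μ : Fin k → ℤ} (hl : Antitone l) (h : μ ≤ l) :
    (krewerasPoly l μ).eval 1 = 1 := by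
  rw [eval_krewerasPoly, Matrix.det_of_isLowerTriangular]
  · refine Finset.prod_eq_one fun i _ => ?_
    have : μ i ≤ l i := h i
    simpa using eval_one_multichoosePoly (by omega)
  · intro i j hij
    have hij' : i < j := hij
    have h1 := Fin.lt_def.1 hij'
    have h2 := hl hij'.le
    have h3 : μ j ≤ l j := h j
    have h4 : (1 : ℚ) + ((i : ℚ) - j) = -((j - i - 1 : ℕ) : ℚ) := by
      rw [Nat.cast_sub (by omega), Nat.cast_sub (by omega)]
      push_cast; ring
    rw [Matrix.of_apply, h4]
    exact eval_neg_multichoosePoly (by omega)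

/-- By the summed Pascal recursion, each column at x + 1 is a tail sum of columns at x, and
neighbouring columns at x are tail sums of each other. The alternating cancellation leaves the
antitone ν; those not below l contribute zero determinants. -/
lemma eval_add_one_krewerasPoly {k : ℕ} {l μ : Fin k → ℤ} (hl : Antitone l) (hμ : Antitone μ)
    (x : ℚ) :
    (krewerasPoly l μ).eval (x + 1) =
      ∑ ν ∈ Finset.Icc μ l with Antitone ν, (krewerasPoly l ν).eval x := by
  -- The summand k absorbs the shift j - i in the degrees, so that the sums up to N miss no nonzero
  -- term.
  obtain ⟨N, hN, hNμ⟩ : ∃ N : ℤ, (∀ i, l i + k < N) ∧ ∀ i, μ i ≤ N := by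
    obtain ⟨A, hA⟩ := (Set.finite_range l).bddAbove
    obtain ⟨B, hB⟩ := (Set.finite_range μ).bddAbove
    refine ⟨max (A + k + 1) B, fun i => ?_, fun i => ?_⟩
    · have := hA ⟨i, rfl⟩
      exact lt_of_lt_of_le (by omega) (le_max_left _ _)
    · exact (hB ⟨i, rfl⟩).trans (le_max_right _ _)
  let G : Fin k → ℤ → Fin k → ℚ := fun j a i =>
    (multichoosePoly (l i - a + j - i)).eval (x + (i - j))
  have hdet : ∀ ν : Fin k → ℤ, (krewerasPoly l ν).eval x =
      (Matrix.detRowAlternating : (Fin k → ℚ) [⋀^Fin k]→ₗ[ℚ] ℚ) (fun j => G j (ν j)) := by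
    intro ν
    rw [eval_krewerasPoly, ← Matrix.det_transpose]
    rfl
  have hsum : (krewerasPoly l μ).eval (x + 1) =
      (Matrix.detRowAlternating : (Fin k → ℚ) [⋀^Fin k]→ₗ[ℚ] ℚ)
        (fun j => ∑ a ∈ Finset.Ico (μ j) N, G j a) := by
    rw [eval_krewerasPoly, ← Matrix.det_transpose]
    change Matrix.det _ = Matrix.det _
    congr 1
    ext j i
    rw [Finset.sum_apply]
    have := sum_Ico_eval_multichoosePoly (D := l i + j - i) (a := μ j) (N := N)
      (by have := hN i; have := j.2; omega) (hNμ j) (x + (i - j))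
    simp only [G, Matrix.transpose_apply, Matrix.of_apply]
    rw [show x + 1 + ((i : ℚ) - j) = x + (i - j) + 1 by ring,
      show l i - μ j + j - i = l i + j - i - μ j by ring, ← this]
    exact Finset.sum_congr rfl fun c _ => by
      rw [show l i - c + j - i = l i + j - i - c by ring]
  rw [hsum, AlternatingMap.map_sum_Ico_eq_sum_antitone _ G μ hμ N]
  · symm
    refine Finset.sum_subset_zero_on_sdiff ?_ ?_ fun ν _ => hdet ν
    · intro ν hν
      simp only [Finset.mem_filter, Finset.mem_Icc, Fintype.mem_piFinset, Finset.mem_Ico] at hν ⊢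
      exact ⟨fun j => ⟨hν.1.1 j, by have : ν j ≤ l j := hν.1.2 j; have := hN j; omega⟩, hν.2⟩
    · intro ν hν
      simp only [Finset.mem_sdiff, Finset.mem_filter, Finset.mem_Icc, Fintype.mem_piFinset,
        Finset.mem_Ico, not_and] at hν
      rw [← hdet, krewerasPoly_of_not_le hl hν.1.2, eval_zero]
      exact fun h => hν.2 ⟨fun j => (hν.1.1 j).1, h⟩ hν.1.2
  · intro j j' hjj' a ha
    ext i
    rw [Finset.sum_apply]
    have := sum_Ico_eval_multichoosePoly (D := l i + j' - i) (a := a + 1) (N := N)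
      (by have := hN i; have := j'.2; omega) (by omega) (x + (i - j'))
    have hcast : (j' : ℚ) = j + 1 := by rw [← hjj']; push_cast; ring
    have hI : Finset.Ico (a + 1) N = Finset.Ioo a N := by ext; simp
    rw [hI] at this
    simp only [G]
    rw [show x + ((i : ℚ) - j) = x + (i - j') + 1 by rw [hcast]; ring,
      show l i - a + j - i = l i + j' - i - (a + 1) by omega, ← this]
    exact Finset.sum_congr rfl fun c _ => by
      rw [show l i - c + j' - i = l i + j' - i - c by ring]

/-- The hypothesis makes every degree index in the lower left block negative, so that block is zero.
-/
lemma krewerasPoly_add {r s : ℕ} (l μ : Fin (r + s) → ℤ)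
    (h : ∀ (i : Fin s) (j : Fin r), l (Fin.natAdd r i) ≤ μ (Fin.castAdd s j)) :
    krewerasPoly l μ = krewerasPoly (l ∘ Fin.castAdd s) (μ ∘ Fin.castAdd s) *
      krewerasPoly (l ∘ Fin.natAdd r) (μ ∘ Fin.natAdd r) := by
  rw [krewerasPoly, ← Matrix.det_submatrix_equiv_self finSumFinEquiv, krewerasPoly, krewerasPoly,
    ← Matrix.det_fromBlocks_zero₂₁ _
      ((krewerasMatrix l μ).submatrix (Fin.castAdd s) (Fin.natAdd r))]
  congr 1
  ext1 i j
  rcases i with i | i <;> rcases j with j | j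
  · simp [krewerasMatrix]
  · simp
  · simp only [Matrix.submatrix_apply, finSumFinEquiv_apply_right, finSumFinEquiv_apply_left,
      Matrix.fromBlocks_apply₂₁, Matrix.zero_apply]
    have := h i j
    have := j.2
    exact krewerasMatrix_eq_zero (by simp; omega)
  · simp only [Matrix.submatrix_apply, finSumFinEquiv_apply_right, Matrix.fromBlocks_apply₂₂,
      krewerasMatrix, Matrix.of_apply, Function.comp_apply, Fin.val_natAdd]
    congr 2
    · push_cast; ring
    · push_cast; simp

lemma coeff_zero_krewerasMatrix {k : ℕ} (l μ : Fin k → ℤ) (i j : Fin k) :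
    (krewerasMatrix l μ i j).coeff 0 =
      (multichoosePoly (l i - μ j + j - i)).eval ((i : ℚ) - j) := by
  simp [coeff_zero_eq_eval_zero, krewerasMatrix]

/-- The first two coefficients of Kreweras' determinant of a connected skew shape. -/
lemma krewerasPoly_connected {n : ℕ} {l μ : Fin (n + 1) → ℤ}
    (h : ∀ i j : Fin (n + 1), (i : ℕ) ≤ j + 1 → μ j < l i) :
    (krewerasPoly l μ).coeff 0 = 0 ∧ 0 ≤ (krewerasPoly l μ).coeff 1 := by
  have hz : ∀ i j : Fin (n + 1), i ≤ j → (krewerasMatrix l μ i j).coeff 0 = 0 := by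
    intro i j hij
    have h1 := Fin.le_def.1 hij
    have h2 := h i j (by omega)
    rw [coeff_zero_krewerasMatrix, show (i : ℚ) - j = -((j - i : ℕ) : ℚ) by
      rw [Nat.cast_sub h1]; ring]
    exact eval_neg_multichoosePoly (by omega)
  -- The top row is divisible by X; A is the matrix after this factor is removed, so the linear
  -- coefficient sought is det A at 0.
  let A : Matrix (Fin (n + 1)) (Fin (n + 1)) ℚ[X] := Matrix.of fun i j =>
    if i = 0 then (krewerasMatrix l μ i j).divX else krewerasMatrix l μ i j
  have hA : krewerasPoly l μ = X * A.det := by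
    have := Matrix.det_mul_column (fun i : Fin (n + 1) => if i = 0 then (X : ℚ[X]) else 1) A
    simp only [Finset.prod_ite_eq', Finset.mem_univ, if_true] at this
    rw [← this, krewerasPoly]
    congr 1
    ext1 i j
    by_cases hi : i = 0
    · subst hi
      have := X_mul_divX_add (krewerasMatrix l μ 0 j)
      rw [hz 0 j (Fin.zero_le _), C_0, add_zero] at this
      simp [A, this]
    · simp [A, hi]
  refine ⟨by rw [hA, coeff_X_mul_zero], ?_⟩
  -- At 0, the rows below the top one vanish on and above the diagonal. The last column thus keeps
  -- only its top entry, whose cofactor has sign (-1)^n and a lower triangular minor with diagonal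
  -- entries 1.
  rw [hA, coeff_X_mul A.det 0, ← constantCoeff_apply, RingHom.map_det,
    Matrix.det_succ_column _ (Fin.last n), Finset.sum_eq_single 0]
  · rw [Matrix.det_of_isLowerTriangular, Finset.prod_eq_one, mul_one]
    · have h1 := h 0 (Fin.last n) (by simp)
      have := coeff_one_multichoosePoly_comp (d := l 0 - μ (Fin.last n) + n) (p := n) (by omega)
      simpa [A, krewerasMatrix, coeff_divX] using this
    · intro i _
      have h1 := h i.succ i.castSucc (by simp)
      simp [A, coeff_zero_krewerasMatrix]
      apply eval_one_multichoosePoly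
      omega
    · intro i j hij
      have hij' : i < j := hij
      have h1 := Fin.lt_def.1 hij'
      have := hz i.succ j.castSucc (Fin.le_def.2 (by simp; omega))
      simpa [A] using this
  · intro i _ hi
    have := hz i (Fin.last n) (Fin.le_last _)
    simp [A, hi, this]
  · simp

lemma coeff_krewerasPoly_nonneg {k : ℕ} {l μ : Fin k → ℤ} (hl : Antitone l) (hμ : Antitone μ) :
    0 ≤ (krewerasPoly l μ).coeff 0 ∧ 0 ≤ (krewerasPoly l μ).coeff 1 := by
  induction k using Nat.strong_induction_on with
  | _ k ih =>
    by_cases hsplit : ∃ r s, k = r + s ∧ 0 < r ∧ 0 < s ∧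
        ∀ i j : Fin k, r ≤ (i : ℕ) → (j : ℕ) < r → l i ≤ μ j
    · obtain ⟨r, s, rfl, hr, hs, h⟩ := hsplit
      rw [krewerasPoly_add l μ fun i j => h _ _ (by simp) (by simp), mul_coeff_zero,
        mul_coeff_one]
      have hc := (Fin.strictMono_castAdd s (n := r)).monotone
      have hn := (Fin.strictMono_natAdd r (m := s)).monotone
      obtain ⟨a0, a1⟩ := ih r (by omega) (hl.comp_monotone hc) (hμ.comp_monotone hc)
      obtain ⟨b0, b1⟩ := ih s (by omega) (hl.comp_monotone hn) (hμ.comp_monotone hn)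
      exact ⟨mul_nonneg a0 b0, add_nonneg (mul_nonneg a0 b1) (mul_nonneg a1 b0)⟩
    · obtain _ | n := k
      · simp [krewerasPoly, coeff_one]
      -- Since l and μ are antitone, the shape splits before row i as soon as l i ≤ μ (i - 1).
      have hadj : ∀ i j : Fin (n + 1), (i : ℕ) = j + 1 → μ j < l i := by
        intro i j hij
        by_contra! hle
        exact hsplit ⟨i, n + 1 - i, by omega, by omega, by omega, fun i' j' hi' hj' =>
          (hl (Fin.le_def.2 hi')).trans (hle.trans (hμ (Fin.le_def.2 (by omega))))⟩
      -- A single row without boxes cannot be split, but is not connected either; its polynomial is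
      -- 0 or 1.
      by_cases hn : n = 0 ∧ l 0 ≤ μ 0
      · obtain ⟨rfl, hle⟩ := hn
        have : krewerasPoly l μ = multichoosePoly (l 0 - μ 0) := by
          simp [krewerasPoly, krewerasMatrix]
        rw [this]
        rcases hle.lt_or_eq with h | h
        · simp [multichoosePoly_of_neg (show l 0 - μ 0 < 0 by omega)]
        · simp [h, multichoosePoly_zero, coeff_one]
      · obtain ⟨h0, h1⟩ := krewerasPoly_connected (l := l) (μ := μ) fun i j hij => by
          by_cases hn0 : n = 0
          · subst hn0
            rw [Fin.fin_one_eq_zero i, Fin.fin_one_eq_zero j]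
            simpa using hn
          · by_cases hjn : (j : ℕ) + 1 < n + 1
            · exact (hadj ⟨j + 1, hjn⟩ j rfl).trans_le (hl (Fin.le_def.2 hij))
            · have h2 := hadj (Fin.last n) ⟨n - 1, by omega⟩ (by simp; omega)
              exact (hμ (Fin.le_def.2 (by simp; omega))).trans_lt
                (h2.trans_le (hl (Fin.le_last i)))
        exact ⟨h0.ge, h1⟩

/-! ### From two nonnegative coefficients to all -/

lemma Polynomial.eq_of_eval_natCast_eq {p q : ℚ[X]}
    (h : ∀ n : ℕ, 1 ≤ n → p.eval (n : ℚ) = q.eval (n : ℚ)) : p = q := by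
  refine Polynomial.eq_of_infinite_eval_eq p q ?_
  refine ((Set.Ici_infinite 1).image (Nat.cast_injective (R := ℚ)).injOn).mono ?_
  rintro _ ⟨n, hn, rfl⟩
  exact h n hn

/-- If the entries of `A ^ n` are polynomials in `n` and their first two coefficients are
nonnegative, then all coefficients are nonnegative: the polynomial matrix satisfies `Z' = Z'(0) Z`. -/
lemma Matrix.coeff_nonneg_of_eval_eq_pow {S : Type*} [Fintype S] [DecidableEq S]
    (A : Matrix S S ℚ) (Z : S → S → ℚ[X])
    (hZ : ∀ n : ℕ, 1 ≤ n → ∀ μ ν, (Z μ ν).eval (n : ℚ) = (A ^ n) μ ν)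
    (h0 : ∀ μ ν, 0 ≤ (Z μ ν).coeff 0) (h1 : ∀ μ ν, 0 ≤ (Z μ ν).coeff 1) (d : ℕ) (μ ν : S) :
    0 ≤ (Z μ ν).coeff d := by
  have hadd : ∀ t : ℕ, 1 ≤ t → ∀ μ ν, (Z μ ν).comp (X + C (t : ℚ)) =
      ∑ κ, Z μ κ * C ((Z κ ν).eval (t : ℚ)) := by
    intro t ht μ ν
    refine Polynomial.eq_of_eval_natCast_eq fun s hs => ?_
    have := hZ (s + t) (by omega) μ ν
    rw [pow_add, Matrix.mul_apply] at this
    push_cast at this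
    simp [eval_finsetSum, this, hZ s hs, hZ t ht]
  -- Differentiation of Z(X + t) = Z(X) Z(t) at X = 0.
  have hder : ∀ μ ν, derivative (Z μ ν) = ∑ κ, C ((Z μ κ).coeff 1) * Z κ ν := by
    intro μ ν
    refine Polynomial.eq_of_eval_natCast_eq fun t ht => ?_
    have := congrArg (fun p => (derivative p).eval 0) (hadd t ht μ ν)
    simpa [derivative_comp, eval_finsetSum, derivative_sum, ← coeff_zero_eq_eval_zero,
      coeff_derivative] using this
  induction d generalizing μ ν with
  | zero => exact h0 μ ν
  | succ d ih =>
    have := congrArg (fun p => p.coeff d) (hder μ ν)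
    simp only [coeff_derivative, finsetSum_coeff, coeff_C_mul] at this
    have h2 : 0 ≤ (Z μ ν).coeff (d + 1) * ((d : ℚ) + 1) := by
      rw [this]
      exact Finset.sum_nonneg fun κ _ => mul_nonneg (h1 μ κ) (ih κ ν)
    exact nonneg_of_mul_nonneg_left h2 (by positivity)

/-! ### Zeta matrices and lower sets of a grid -/

section
open scoped Classical

/-- The zeta matrix of a finite partial order. -/
noncomputable def zetaMatrix (S : Type*) [PartialOrder S] : Matrix S S ℚ :=
  Matrix.of fun μ ν => if μ ≤ ν then 1 else 0

variable {S : Type*} [Fintype S] [PartialOrder S]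

/-- The zeta matrix is unitriangular, hence injective; the induction runs downwards from the maximal
elements. -/
lemma eq_of_zetaMatrix_mul_eq {f g : S → ℚ}
    (h : ∀ μ, ∑ κ, zetaMatrix S μ κ * f κ = ∑ κ, zetaMatrix S μ κ * g κ) : f = g := by
  funext μ
  induction μ using WellFoundedGT.induction with
  | _ μ ih =>
    have h1 := h μ
    rw [← Finset.add_sum_erase _ _ (Finset.mem_univ μ),
      ← Finset.add_sum_erase _ (fun κ => zetaMatrix S μ κ * g κ) (Finset.mem_univ μ)] at h1
    have h2 : ∑ κ ∈ Finset.univ.erase μ, zetaMatrix S μ κ * f κ =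
        ∑ κ ∈ Finset.univ.erase μ, zetaMatrix S μ κ * g κ := by
      refine Finset.sum_congr rfl fun κ hκ => ?_
      by_cases hle : μ ≤ κ
      · rw [ih κ (lt_of_le_of_ne hle (Finset.ne_of_mem_erase hκ).symm)]
      · simp [zetaMatrix, hle]
    rw [h2] at h1
    simpa [zetaMatrix] using add_right_cancel h1

/-- The identity ζ Z(X) = Z(X + 1) extends from positive integers to X = 0, where it reads ζ Z(0) =
ζ; then ζ is cancelled. -/
lemma eval_zero_of_eval_eq_zetaMatrix_pow (Z : S → S → ℚ[X])
    (hZ : ∀ n : ℕ, 1 ≤ n → ∀ μ ν, (Z μ ν).eval (n : ℚ) = (zetaMatrix S ^ n) μ ν) (μ ν : S) :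
    (Z μ ν).eval 0 = (1 : Matrix S S ℚ) μ ν := by
  refine congrFun (eq_of_zetaMatrix_mul_eq (f := fun μ => (Z μ ν).eval 0)
    (g := fun μ => (1 : Matrix S S ℚ) μ ν) fun μ => ?_) μ
  have : ∑ κ, C (zetaMatrix S μ κ) * Z κ ν = (Z μ ν).comp (X + 1) := by
    refine Polynomial.eq_of_eval_natCast_eq fun n hn => ?_
    have := hZ (n + 1) (by omega) μ ν
    rw [pow_succ', Matrix.mul_apply] at this
    push_cast at this
    simp [eval_finsetSum, this, hZ n hn]
  have h0 := congrArg (fun p => p.eval 0) this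
  have h1 := hZ 1 le_rfl μ ν
  simp only [eval_finsetSum, eval_mul, eval_C, eval_comp, eval_add, eval_X, eval_one,
    zero_add] at h0
  rw [Nat.cast_one, pow_one] at h1
  rw [h0, h1, ← Matrix.mul_apply, mul_one]

noncomputable instance LowerSet.instFintype {P : Type*} [LE P] [Finite P] :
    Fintype (LowerSet P) :=
  have : Finite (LowerSet P) := Finite.of_injective _ SetLike.coe_injective
  Fintype.ofFinite _

/-- The row lengths of a lower set of a grid. -/
noncomputable def LowerSet.rowLength {k m : ℕ} (ν : LowerSet (Fin k × Fin m)) (i : Fin k) : ℤ :=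
  (Finset.univ.filter fun j : Fin m => (i, j) ∈ ν).card

namespace LowerSet

variable {k m : ℕ}

lemma lt_rowLength_iff (ν : LowerSet (Fin k × Fin m)) (i : Fin k) (j : Fin m) :
    ((j : ℕ) : ℤ) < ν.rowLength i ↔ (i, j) ∈ ν := by
  rw [rowLength, Nat.cast_lt]
  constructor
  · intro h
    by_contra hj
    have : (Finset.univ.filter fun j : Fin m => (i, j) ∈ ν) ⊆ Finset.Iio j := by
      intro j' hj'
      rw [Finset.mem_filter] at hj'
      rw [Finset.mem_Iio]
      by_contra! hle
      exact hj (ν.lower (Prod.mk_le_mk.2 ⟨le_rfl, hle⟩) hj'.2)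
    have := Finset.card_le_card this
    rw [Fin.card_Iio] at this
    omega
  · intro h
    have : Finset.Iic j ⊆ (Finset.univ.filter fun j : Fin m => (i, j) ∈ ν) := by
      intro j' hj'
      rw [Finset.mem_Iic] at hj'
      rw [Finset.mem_filter]
      exact ⟨Finset.mem_univ _, ν.lower (Prod.mk_le_mk.2 ⟨le_rfl, hj'⟩) h⟩
    have := Finset.card_le_card this
    rw [Fin.card_Iic] at this
    omega

lemma rowLength_mono {μ ν : LowerSet (Fin k × Fin m)} (h : μ ≤ ν) : μ.rowLength ≤ ν.rowLength :=
  fun i => Int.ofNat_le.2 (Finset.card_le_card fun j hj => by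
    rw [Finset.mem_filter] at hj ⊢
    exact ⟨hj.1, h hj.2⟩)

lemma rowLength_le_iff {μ ν : LowerSet (Fin k × Fin m)} : μ.rowLength ≤ ν.rowLength ↔ μ ≤ ν :=
  ⟨fun h p hp => (lt_rowLength_iff ν p.1 p.2).1
    (((lt_rowLength_iff μ p.1 p.2).2 hp).trans_le (h p.1)), rowLength_mono⟩

lemma antitone_rowLength (ν : LowerSet (Fin k × Fin m)) : Antitone ν.rowLength :=
  fun i i' hi => Int.ofNat_le.2 (Finset.card_le_card fun j hj => by
    rw [Finset.mem_filter] at hj ⊢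
    exact ⟨hj.1, ν.lower (Prod.mk_le_mk.2 ⟨hi, le_rfl⟩) hj.2⟩)

lemma rowLength_injective : Function.Injective (rowLength : LowerSet (Fin k × Fin m) → _) :=
  fun _ _ h => le_antisymm (rowLength_le_iff.1 h.le) (rowLength_le_iff.1 h.ge)

lemma exists_rowLength_eq {f : Fin k → ℤ} (hf : Antitone f) (h0 : ∀ i, 0 ≤ f i)
    (hm : ∀ i, f i ≤ m) : ∃ ν : LowerSet (Fin k × Fin m), ν.rowLength = f := by
  have hlow : IsLowerSet {p : Fin k × Fin m | ((p.2 : ℕ) : ℤ) < f p.1} := by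
    rintro ⟨i, j⟩ ⟨i', j'⟩ hle hp
    obtain ⟨hi, hj⟩ := Prod.mk_le_mk.1 hle
    have := hf hi
    have := Fin.le_def.1 hj
    simp only [Set.mem_ofPred_eq] at hp ⊢
    omega
  refine ⟨⟨_, hlow⟩, funext fun i => ?_⟩
  obtain ⟨a, ha⟩ := Int.eq_ofNat_of_zero_le (h0 i)
  have ham := hm i
  rw [ha] at ham ⊢
  have ham' : a ≤ m := by exact_mod_cast ham
  rw [rowLength, Nat.cast_inj]
  have h1 : (Finset.univ.filter fun j : Fin m => (i, j) ∈
      (⟨_, hlow⟩ : LowerSet (Fin k × Fin m))) =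
      Finset.univ.filter fun j : Fin m => (j : ℕ) < a := by
    refine Finset.filter_congr fun j _ => ?_
    rw [LowerSet.mem_mk, Set.mem_ofPred_eq, ha]
    simp
  rw [h1, Fin.card_filter_val_lt, min_eq_right ham']

end LowerSet

/-- The powers of the zeta matrix of the lattice of lower sets of a grid are given by
polynomials with nonnegative coefficients. -/
theorem exists_poly_eval_eq_zetaMatrix_pow (k m : ℕ) :
    ∃ Z : LowerSet (Fin k × Fin m) → LowerSet (Fin k × Fin m) → ℚ[X],
      (∀ (n : ℕ) μ ν, (Z μ ν).eval (n : ℚ) = (zetaMatrix (LowerSet (Fin k × Fin m)) ^ n) μ ν) ∧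
      ∀ μ ν d, 0 ≤ (Z μ ν).coeff d := by
  let Z : LowerSet (Fin k × Fin m) → LowerSet (Fin k × Fin m) → ℚ[X] :=
    fun μ ν => krewerasPoly ν.rowLength μ.rowLength
  have hstep : ∀ (x : ℚ) μ ν, (Z μ ν).eval (x + 1) =
      ∑ κ, zetaMatrix (LowerSet (Fin k × Fin m)) μ κ * (Z κ ν).eval x := by
    intro x μ ν
    simp only [Z]
    rw [eval_add_one_krewerasPoly ν.antitone_rowLength μ.antitone_rowLength]
    have h1 : ∑ κ, zetaMatrix (LowerSet (Fin k × Fin m)) μ κ *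
        (krewerasPoly ν.rowLength κ.rowLength).eval x =
        ∑ κ ∈ Finset.univ.filter (fun κ : LowerSet (Fin k × Fin m) => μ ≤ κ ∧ κ ≤ ν),
          (krewerasPoly ν.rowLength κ.rowLength).eval x := by
      rw [Finset.sum_filter]
      refine Finset.sum_congr rfl fun κ _ => ?_
      by_cases h : κ ≤ ν
      · simp [zetaMatrix, h]
      · rw [krewerasPoly_of_not_le ν.antitone_rowLength κ.antitone_rowLength
          (fun h' => h (LowerSet.rowLength_le_iff.1 h'))]
        simp
    rw [h1]
    symm
    refine Finset.sum_nbij LowerSet.rowLength ?_ LowerSet.rowLength_injective.injOn ?_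
      fun _ _ => rfl
    · intro κ hκ
      simp only [Finset.mem_filter, Finset.mem_univ, true_and, Finset.mem_Icc] at hκ ⊢
      exact ⟨⟨LowerSet.rowLength_mono hκ.1, LowerSet.rowLength_mono hκ.2⟩, κ.antitone_rowLength⟩
    · intro f hf
      simp only [Finset.coe_filter, Finset.mem_Icc, Set.mem_ofPred_eq] at hf
      obtain ⟨⟨hμ, hν⟩, hanti⟩ := hf
      obtain ⟨κ, rfl⟩ := LowerSet.exists_rowLength_eq (m := m) hanti
        (fun i => le_trans (Int.natCast_nonneg _) (hμ i))
        (fun i => (hν i).trans (Int.ofNat_le.2 ((Finset.card_le_univ _).trans_eq (by simp))))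
      refine ⟨κ, ?_, rfl⟩
      simpa using ⟨LowerSet.rowLength_le_iff.1 hμ, LowerSet.rowLength_le_iff.1 hν⟩
  have hpos : ∀ n : ℕ, 1 ≤ n → ∀ μ ν,
      (Z μ ν).eval (n : ℚ) = (zetaMatrix (LowerSet (Fin k × Fin m)) ^ n) μ ν := by
    intro n hn
    induction n, hn using Nat.le_induction with
    | base =>
      intro μ ν
      rw [Nat.cast_one, pow_one, zetaMatrix, Matrix.of_apply]
      split_ifs with h
      · exact eval_one_krewerasPoly ν.antitone_rowLength (LowerSet.rowLength_mono h)
      · simp only [Z]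
        rw [krewerasPoly_of_not_le ν.antitone_rowLength μ.antitone_rowLength
          (fun h' => h (LowerSet.rowLength_le_iff.1 h')), eval_zero]
    | succ n hn ih =>
      intro μ ν
      rw [Nat.cast_succ, hstep, pow_succ', Matrix.mul_apply]
      simp only [ih]
  refine ⟨Z, fun n μ ν => ?_, fun μ ν d => ?_⟩
  · rcases n.eq_zero_or_pos with rfl | hn
    · rw [Nat.cast_zero, pow_zero]
      exact eval_zero_of_eval_eq_zetaMatrix_pow Z hpos μ ν
    · exact hpos n hn μ ν
  · exact Matrix.coeff_nonneg_of_eval_eq_pow _ Z hpos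
      (fun μ ν => (coeff_krewerasPoly_nonneg ν.antitone_rowLength μ.antitone_rowLength).1)
      (fun μ ν => (coeff_krewerasPoly_nonneg ν.antitone_rowLength μ.antitone_rowLength).2) d μ ν

end

/-! ### Counting monotone maps level by level -/

section
open scoped Classical

variable {P : Type*} [Fintype P] [PartialOrder P]

lemma zetaMatrix_pow_eq_zero {S : Type*} [Fintype S] [PartialOrder S] (n : ℕ) {μ ν : S}
    (h : ¬ μ ≤ ν) : (zetaMatrix S ^ n) μ ν = 0 := by
  induction n generalizing ν with
  | zero =>
    rw [pow_zero, Matrix.one_apply_ne]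
    rintro rfl
    exact h le_rfl
  | succ n ih =>
    rw [pow_succ, Matrix.mul_apply]
    refine Finset.sum_eq_zero fun κ _ => ?_
    by_cases hκ : μ ≤ κ
    · rw [zetaMatrix, Matrix.of_apply, if_neg fun h' => h (hκ.trans h'), mul_zero]
    · rw [ih hκ, zero_mul]

/-- The order preserving maps with values at most `hi`, truncated at the height `t`, which are
smaller than `t` precisely on `ν`, where they are at least `lo`. -/
noncomputable def truncatedMaps (lo hi : P → ℕ) (t : ℕ) (ν : LowerSet P) : Finset (P → ℕ) :=
  (Fintype.piFinset fun _ => Finset.range (t + 1)).filter fun x =>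
    Monotone x ∧ (∀ p, x p ≤ hi p) ∧ (∀ p, x p < t → lo p ≤ x p) ∧ ∀ p, x p < t ↔ p ∈ ν

lemma mem_truncatedMaps {lo hi : P → ℕ} {t : ℕ} {ν : LowerSet P} {x : P → ℕ} :
    x ∈ truncatedMaps lo hi t ν ↔ (∀ p, x p ≤ t) ∧ Monotone x ∧ (∀ p, x p ≤ hi p) ∧
      (∀ p, x p < t → lo p ≤ x p) ∧ ∀ p, x p < t ↔ p ∈ ν := by
  simp [truncatedMaps]

lemma card_truncatedMaps_zero (lo hi : P → ℕ) (ν : LowerSet P) :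
    (truncatedMaps lo hi 0 ν).card = if ν = ⊥ then 1 else 0 := by
  split_ifs with h
  · subst h
    rw [Finset.card_eq_one]
    refine ⟨fun _ => 0, ?_⟩
    ext x
    rw [mem_truncatedMaps, Finset.mem_singleton]
    constructor
    · exact fun hx => funext fun p => Nat.le_zero.1 (hx.1 p)
    · rintro rfl
      exact ⟨fun _ => le_rfl, fun _ _ _ => le_rfl, fun _ => Nat.zero_le _, by simp, by simp⟩
  · rw [Finset.card_eq_zero, Finset.eq_empty_iff_forall_notMem]
    intro x hx
    refine h (le_bot_iff.1 fun p hp => ?_)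
    have := ((mem_truncatedMaps.1 hx).2.2.2.2 p).2 hp
    omega

/-- Let μ = {x < t}. A map truncated at t + 1 is recovered from its truncation at t together with ν,
being t on ν \ μ and t + 1 off ν. The bounds require A ≤ ν, as x ≤ t on A, and ν ≤ B, as `lo` ≤ t on
ν. -/
lemma card_truncatedMaps_succ {lo hi : P → ℕ} {t : ℕ} {A B : LowerSet P}
    (hA : ∀ p, p ∈ A ↔ hi p ≤ t) (hB : ∀ p, p ∈ B ↔ lo p ≤ t) (ν : LowerSet P) :
    (truncatedMaps lo hi (t + 1) ν).card =
      ∑ μ, if μ ⊔ A ≤ ν ∧ ν ≤ B then (truncatedMaps lo hi t μ).card else 0 := by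
  let g : (P → ℕ) → LowerSet P := fun x =>
    if h : IsLowerSet {p | x p < t} then ⟨_, h⟩ else ⊥
  have hg : ∀ x, Monotone x → ∀ p, p ∈ g x ↔ x p < t := by
    intro x hx p
    have : IsLowerSet {p | x p < t} := fun a b hba ha => (hx hba).trans_lt ha
    simp only [g, dif_pos this]
    rfl
  rw [Finset.card_eq_sum_card_fiberwise (f := g) (t := Finset.univ) (fun _ _ => by simp)]
  refine Finset.sum_congr rfl fun μ _ => ?_
  have hmem : ∀ x, x ∈ (truncatedMaps lo hi (t + 1) ν).filter (fun x => g x = μ) ↔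
      ((∀ p, x p ≤ t + 1) ∧ Monotone x ∧ (∀ p, x p ≤ hi p) ∧
      (∀ p, x p < t + 1 → lo p ≤ x p) ∧ ∀ p, x p < t + 1 ↔ p ∈ ν) ∧ ∀ p, x p < t ↔ p ∈ μ := by
    intro x
    rw [Finset.mem_filter, mem_truncatedMaps]
    refine and_congr_right fun hx => ⟨?_, ?_⟩
    · rintro rfl p
      exact (hg x hx.2.1 p).symm
    · intro h
      ext p
      exact (hg x hx.2.1 p).trans (h p)
  split_ifs with hle
  · obtain ⟨hle1, hνB⟩ := hle
    obtain ⟨hμν, hAν⟩ := sup_le_iff.1 hle1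
    refine Finset.card_nbij' (fun x p => min (x p) t)
      (fun y p => if p ∈ μ then y p else if p ∈ ν then t else t + 1) ?_ ?_ ?_ ?_
    · intro x hx
      obtain ⟨⟨-, h2, h3, h4, -⟩, h6⟩ := (hmem x).1 hx
      refine mem_truncatedMaps.2 ⟨fun p => min_le_right _ _, h2.min monotone_const,
        fun p => (min_le_left _ _).trans (h3 p), fun p hp => ?_, fun p => ?_⟩
      · have := h4 p
        simp only [min_def] at hp ⊢
        split_ifs at hp ⊢ <;> omega
      · rw [← h6]
        simp
    · intro y hy
      obtain ⟨h1, h2, h3, h4, h5⟩ := mem_truncatedMaps.1 hy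
      have hyt : ∀ p, p ∉ μ → y p = t := fun p hp =>
        le_antisymm (h1 p) (not_lt.1 fun h => hp ((h5 p).1 h))
      refine (hmem _).2 ⟨⟨fun p => ?_, fun p q hpq => ?_, fun p => ?_, fun p => ?_, fun p => ?_⟩,
        fun p => ?_⟩
      · have := h1 p
        dsimp only
        split_ifs <;> omega
      · have e1 := h2 hpq
        have e2 := h1 p
        have e3 : q ∈ μ → p ∈ μ := fun h => μ.lower hpq h
        have e4 : q ∈ ν → p ∈ ν := fun h => ν.lower hpq h
        dsimp only
        split_ifs <;> first | omega | tauto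
      · have e1 := h3 p
        have e2 := hyt p
        have e3 : hi p ≤ t → p ∈ ν := fun h => hAν ((hA p).2 h)
        dsimp only
        split_ifs with a b
        · exact e1
        · rw [e2 a] at e1; exact e1
        · by_contra hc
          exact b (e3 (by omega))
      · have e1 := h4 p
        have e2 := h5 p
        have e3 : p ∈ ν → lo p ≤ t := fun h => (hB p).1 (hνB h)
        dsimp only
        split_ifs with a b
        · exact fun _ => e1 (e2.2 a)
        · exact fun _ => e3 b
        · omega
      · have e1 : p ∈ μ → p ∈ ν := fun h => hμν h
        have e2 := h1 p
        dsimp only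
        split_ifs with a b
        · exact ⟨fun _ => e1 a, fun _ => by omega⟩
        · exact ⟨fun _ => b, fun _ => by omega⟩
        · exact ⟨fun h => by omega, fun h => absurd h b⟩
      · have e2 := h5 p
        dsimp only
        split_ifs with a b
        · exact e2
        · exact ⟨fun h => by omega, fun h => absurd h a⟩
        · exact ⟨fun h => by omega, fun h => absurd h a⟩
    · intro x hx
      obtain ⟨⟨h1, -, -, -, h5⟩, h6⟩ := (hmem x).1 hx
      funext p
      have e1 := h1 p
      have e5 := h5 p
      have e6 := h6 p
      dsimp only
      split_ifs with a b
      · rw [min_eq_left]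
        exact (e6.2 a).le
      · have := e5.2 b
        have : ¬ x p < t := fun h => a (e6.1 h)
        omega
      · have : ¬ x p < t + 1 := fun h => b (e5.1 h)
        omega
    · intro y hy
      obtain ⟨h1, -, -, -, h5⟩ := mem_truncatedMaps.1 hy
      funext p
      have e1 := h1 p
      have e5 := h5 p
      dsimp only
      split_ifs with a b
      · exact min_eq_left e1
      · have : ¬ y p < t := fun h => a (e5.1 h)
        simp; omega
      · have : ¬ y p < t := fun h => a (e5.1 h)
        simp; omega
  · rw [Finset.card_eq_zero, Finset.eq_empty_iff_forall_notMem]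
    intro x hx
    obtain ⟨⟨h1, h2, h3, h4, h5⟩, h6⟩ := (hmem x).1 hx
    refine hle ⟨sup_le (fun p hp => ?_) (fun p hp => ?_), fun p hp => ?_⟩
    · exact (h5 p).1 (((h6 p).2 hp).trans (Nat.lt_succ_self t))
    · exact (h5 p).1 (Nat.lt_succ_of_le ((h3 p).trans ((hA p).1 hp)))
    · have h := (h5 p).2 hp
      exact (hB p).2 ((h4 p h).trans (Nat.lt_succ_iff.1 h))

/-- When A and B do not change, joining with A matters only in the first step, since later sets
already contain A, and the bound B only in the last, since earlier sets are smaller. This needs at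
least one step. -/
lemma card_truncatedMaps_add {lo hi : P → ℕ} {t n : ℕ} {A B : LowerSet P}
    (hA : ∀ s < n, ∀ p, p ∈ A ↔ hi p ≤ t + s) (hB : ∀ s < n, ∀ p, p ∈ B ↔ lo p ≤ t + s)
    (hn : 1 ≤ n) (ν : LowerSet P) :
    ((truncatedMaps lo hi (t + n) ν).card : ℚ) = if ν ≤ B then
      ∑ μ, ((truncatedMaps lo hi t μ).card : ℚ) * (zetaMatrix (LowerSet P) ^ n) (μ ⊔ A) ν
      else 0 := by
  induction n, hn using Nat.le_induction generalizing ν with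
  | base =>
    rw [card_truncatedMaps_succ (hA 0 one_pos) (hB 0 one_pos)]
    push_cast
    by_cases h : ν ≤ B <;> simp [h, zetaMatrix]
  | succ n hn ih =>
    rw [← add_assoc, card_truncatedMaps_succ (hA n (Nat.lt_succ_self n)) (hB n (Nat.lt_succ_self n))]
    push_cast
    simp only [ih (fun s hs => hA s (hs.trans (Nat.lt_succ_self n)))
      (fun s hs => hB s (hs.trans (Nat.lt_succ_self n)))]
    by_cases h : ν ≤ B
    swap
    · simp [h]
    rw [if_pos h]
    have h1 : ∀ κ : LowerSet P, (if κ ⊔ A ≤ ν ∧ ν ≤ B then if κ ≤ B then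
        ∑ μ, ((truncatedMaps lo hi t μ).card : ℚ) * (zetaMatrix (LowerSet P) ^ n) (μ ⊔ A) κ
        else 0 else 0) = ∑ μ, ((truncatedMaps lo hi t μ).card : ℚ) *
          ((zetaMatrix (LowerSet P) ^ n) (μ ⊔ A) κ * zetaMatrix (LowerSet P) κ ν) := by
      intro κ
      by_cases hκ : κ ≤ ν
      · rw [if_pos (hκ.trans h)]
        simp only [zetaMatrix, Matrix.of_apply, if_pos hκ, mul_one]
        split_ifs with h2
        · rfl
        · symm
          refine Finset.sum_eq_zero fun μ _ => ?_
          change _ * (zetaMatrix (LowerSet P) ^ n) _ _ = 0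
          rw [zetaMatrix_pow_eq_zero, mul_zero]
          exact fun h3 => h2 ⟨sup_le hκ ((le_sup_right.trans h3).trans hκ), h⟩
      · rw [if_neg fun h2 => hκ (le_sup_left.trans h2.1)]
        simp [zetaMatrix, hκ]
    rw [Finset.sum_congr rfl fun κ _ => h1 κ, Finset.sum_comm]
    refine Finset.sum_congr rfl fun μ _ => ?_
    rw [← Finset.mul_sum, pow_succ, Matrix.mul_apply]

/-- The lower set on which a monotone map is at most `v`. -/
def LowerSet.sublevel {P : Type*} [PartialOrder P] {f : P → ℕ} (hf : Monotone f) (v : ℕ) : LowerSet P :=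
  ⟨{p | f p ≤ v}, fun _ _ hba ha => (hf hba).trans ha⟩

lemma LowerSet.mem_sublevel {P : Type*} [PartialOrder P] {f : P → ℕ} (hf : Monotone f) {v : ℕ} {p : P} :
    p ∈ LowerSet.sublevel hf v ↔ f p ≤ v := Iff.rfl

/-- The counting polynomials of the truncations of the dilates at the heights `n v`. -/
noncomputable def transferPoly {lo hi : P → ℕ} (hlo : Monotone lo) (hhi : Monotone hi)
    (Z : LowerSet P → LowerSet P → ℚ[X]) : ℕ → LowerSet P → ℚ[X]
  | 0, ν => if ν = ⊥ then 1 else 0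
  | v + 1, ν => if ν ≤ LowerSet.sublevel hlo v then
      ∑ μ, transferPoly hlo hhi Z v μ * Z (μ ⊔ LowerSet.sublevel hhi v) ν else 0

section transferPoly

variable {lo hi : P → ℕ} (hlo : Monotone lo) (hhi : Monotone hi)
  {Z : LowerSet P → LowerSet P → ℚ[X]}

lemma transferPoly_zero (ν : LowerSet P) :
    transferPoly hlo hhi Z 0 ν = if ν = ⊥ then 1 else 0 := rfl

lemma transferPoly_succ (v : ℕ) (ν : LowerSet P) :
    transferPoly hlo hhi Z (v + 1) ν = if ν ≤ LowerSet.sublevel hlo v then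
      ∑ μ, transferPoly hlo hhi Z v μ * Z (μ ⊔ LowerSet.sublevel hhi v) ν else 0 := rfl

lemma coeff_transferPoly_nonneg (hZ0 : ∀ μ ν d, 0 ≤ (Z μ ν).coeff d) :
    ∀ v ν d, 0 ≤ (transferPoly hlo hhi Z v ν).coeff d := by
  intro v
  induction v with
  | zero =>
    intro ν d
    rw [transferPoly_zero]
    split_ifs
    · rw [coeff_one]
      split_ifs <;> simp
    · simp
  | succ v ih =>
    intro ν d
    rw [transferPoly_succ]
    split_ifs
    · rw [finsetSum_coeff]
      refine Finset.sum_nonneg fun μ _ => ?_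
      rw [coeff_mul]
      exact Finset.sum_nonneg fun q _ => mul_nonneg (ih _ _) (hZ0 _ _ _)
    · simp

lemma card_truncatedMaps_eq_eval_transferPoly
    (hZ : ∀ (n : ℕ) μ ν, (Z μ ν).eval (n : ℚ) = (zetaMatrix (LowerSet P) ^ n) μ ν) :
    ∀ n : ℕ, 1 ≤ n → ∀ v ν, ((truncatedMaps (fun p => n * lo p) (fun p => n * hi p)
      (n * v) ν).card : ℚ) = (transferPoly hlo hhi Z v ν).eval (n : ℚ) := by
  intro n hn v
  induction v with
  | zero =>
    intro ν
    rw [mul_zero, card_truncatedMaps_zero, transferPoly_zero]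
    split_ifs <;> simp
  | succ v ih =>
    intro ν
    -- Within a block of n heights the sublevel sets of n * `lo` and n * `hi` are constant.
    have hblock : ∀ s < n, ∀ a : ℕ, a ≤ v ↔ n * a ≤ n * v + s := by
      intro s hs a
      constructor
      · intro h
        exact (Nat.mul_le_mul_left n h).trans (Nat.le_add_right _ _)
      · intro h
        by_contra! hc
        have := Nat.mul_le_mul_left n (Nat.succ_le_of_lt hc)
        rw [Nat.succ_eq_add_one, mul_add, mul_one] at this
        omega
    rw [mul_add, mul_one, card_truncatedMaps_add (A := LowerSet.sublevel hhi v)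
      (B := LowerSet.sublevel hlo v)
      (fun s hs p => (LowerSet.mem_sublevel hhi).trans (hblock s hs _))
      (fun s hs p => (LowerSet.mem_sublevel hlo).trans (hblock s hs _)) hn, transferPoly_succ]
    split_ifs
    · rw [eval_finsetSum]
      refine Finset.sum_congr rfl fun μ _ => ?_
      rw [eval_mul, ih, hZ]
    · simp

/-- The block argument needs n ≥ 1, so n = 0 is treated separately. There Z(0) is the identity and
the only surviving chain consists of the sets {hi < v}; `lo ≤ hi` makes it admissible. -/
lemma eval_zero_transferPoly (hle : lo ≤ hi)
    (hZ : ∀ (n : ℕ) μ ν, (Z μ ν).eval (n : ℚ) = (zetaMatrix (LowerSet P) ^ n) μ ν) :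
    ∀ v ν, (transferPoly hlo hhi Z v ν).eval 0 =
      if (∀ p, p ∈ ν ↔ hi p < v) then 1 else 0 := by
  intro v
  induction v with
  | zero =>
    intro ν
    rw [transferPoly_zero]
    have : (∀ p, p ∈ ν ↔ hi p < 0) ↔ ν = ⊥ := by
      constructor
      · intro h
        ext p
        simpa using h p
      · rintro rfl p
        simp
    simp only [this]
    split_ifs <;> simp
  | succ v ih =>
    intro ν
    have hc : IsLowerSet {p | hi p < v} := fun _ _ hba ha => (hhi hba).trans_lt ha
    have h1 : ∀ μ : LowerSet P, (∀ p, p ∈ μ ↔ hi p < v) ↔ μ = ⟨_, hc⟩ := by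
      intro μ
      constructor
      · intro h
        ext p
        exact h p
      · rintro rfl p
        rfl
    have h2 : (⟨_, hc⟩ : LowerSet P) ⊔ LowerSet.sublevel hhi v = LowerSet.sublevel hhi v :=
      sup_eq_right.2 fun p hp => show hi p ≤ v from le_of_lt hp
    have h3 : (∀ p, p ∈ ν ↔ hi p < v + 1) ↔ LowerSet.sublevel hhi v = ν := by
      constructor
      · intro h
        ext p
        exact Nat.lt_succ_iff.symm.trans (h p).symm
      · rintro rfl p
        exact Nat.lt_succ_iff.symm
    have hZ' : ∀ μ κ, (Z μ κ).eval 0 = if μ = κ then 1 else 0 := fun μ κ => by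
      have := hZ 0 μ κ
      rw [Nat.cast_zero, pow_zero, Matrix.one_apply] at this
      exact this
    rw [transferPoly_succ]
    simp only [h3]
    have hsum : (∑ μ, transferPoly hlo hhi Z v μ * Z (μ ⊔ LowerSet.sublevel hhi v) ν).eval 0 =
        if LowerSet.sublevel hhi v = ν then 1 else 0 := by
      simp only [eval_finsetSum, eval_mul, ih, hZ', h1, ite_mul, one_mul, zero_mul,
        Finset.sum_ite_eq', Finset.mem_univ, if_true, h2]
    split_ifs with ha hb hb
    · rw [hsum, if_pos hb]
    · rw [hsum, if_neg hb]
    · subst hb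
      exact absurd (fun p hp => (hle p).trans hp) ha
    · simp

end transferPoly

/-- Counting order preserving maps between the dilates of two marking functions. -/
theorem exists_poly_card_monotone {lo hi : P → ℕ} (hlo : Monotone lo) (hhi : Monotone hi)
    (hle : lo ≤ hi) (Z : LowerSet P → LowerSet P → ℚ[X])
    (hZ : ∀ (n : ℕ) μ ν, (Z μ ν).eval (n : ℚ) = (zetaMatrix (LowerSet P) ^ n) μ ν)
    (hZ0 : ∀ μ ν d, 0 ≤ (Z μ ν).coeff d) :
    ∃ E : ℚ[X], (∀ n : ℕ, (((Fintype.piFinset fun p => Finset.Icc (n * lo p) (n * hi p)).filter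
      Monotone).card : ℚ) = E.eval (n : ℚ)) ∧ ∀ d, 0 ≤ E.coeff d := by
  -- At height n(V + 1) truncation has no effect for n ≥ 1, and the lower set is everything.
  obtain ⟨V, hV⟩ := (Set.finite_range hi).bddAbove
  have hV' : ∀ p, hi p < V + 1 := fun p => Nat.lt_succ_of_le (hV ⟨p, rfl⟩)
  refine ⟨transferPoly hlo hhi Z (V + 1) ⊤, fun n => ?_,
    coeff_transferPoly_nonneg hlo hhi hZ0 _ _⟩
  rcases n.eq_zero_or_pos with rfl | hn
  · rw [Nat.cast_zero, eval_zero_transferPoly hlo hhi hle hZ, if_pos (by simpa using hV')]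
    have : ((Fintype.piFinset fun p => Finset.Icc (0 * lo p) (0 * hi p)).filter Monotone) =
        {fun _ => 0} := by
      ext x
      simp only [zero_mul, Finset.Icc_self, Finset.mem_filter, Fintype.mem_piFinset,
        Finset.mem_singleton]
      constructor
      · exact fun h => funext h.1
      · rintro rfl
        exact ⟨fun _ => rfl, monotone_const⟩
    rw [this]
    simp
  · rw [← card_truncatedMaps_eq_eval_transferPoly hlo hhi hZ n hn]
    congr 2
    ext x
    rw [mem_truncatedMaps]
    simp only [Finset.mem_filter, Fintype.mem_piFinset, Finset.mem_Icc]
    have hlt : ∀ p, x p ≤ n * hi p → x p < n * (V + 1) := fun p hp =>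
      hp.trans_lt (Nat.mul_lt_mul_of_pos_left (hV' p) hn)
    constructor
    · rintro ⟨h1, h2⟩
      exact ⟨fun p => (hlt p (h1 p).2).le, h2, fun p => (h1 p).2, fun p _ => (h1 p).1,
        fun p => by simpa using hlt p (h1 p).2⟩
    · rintro ⟨-, h2, h3, h4, -⟩
      exact ⟨fun p => ⟨h4 p (hlt p (h3 p)), h3 p⟩, h2⟩

end

/-! ### Integrality of the polytope and lattice points of its dilates -/

section
open scoped Classical
open MeasureTheory

/-- The marked order polytope of the order preserving maps between `lo` and `hi`. -/
def boundedOrderPolytope {P : Type*} [PartialOrder P] (lo hi : P → ℕ) : Set (P → ℝ) :=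
  {x | Monotone x ∧ ∀ p, (lo p : ℝ) ≤ x p ∧ x p ≤ hi p}

lemma convex_boundedOrderPolytope {P : Type*} [PartialOrder P] (lo hi : P → ℕ) :
    Convex ℝ (boundedOrderPolytope lo hi) := by
  intro x hx y hy a b ha hb hab
  refine ⟨fun p q hpq => add_le_add (mul_le_mul_of_nonneg_left (hx.1 hpq) ha)
    (mul_le_mul_of_nonneg_left (hy.1 hpq) hb), fun p => ?_⟩
  exact convex_Icc (lo p : ℝ) (hi p) ⟨(hx.2 p).1, (hx.2 p).2⟩ ⟨(hy.2 p).1, (hy.2 p).2⟩ ha hb hab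

/-- As θ runs through [0, 1), the floor jumps at most once, when θ reaches one minus the fractional
part of a. -/
lemma Nat.floor_add_eq_indicator {a θ : ℝ} (ha : 0 ≤ a) (hθ : θ ∈ Set.Ico (0 : ℝ) 1) :
    ((⌊a + θ⌋₊ : ℕ) : ℝ) =
      (⌊a⌋₊ : ℝ) + (Set.Ici (1 - (a - ⌊a⌋₊))).indicator (1 : ℝ → ℝ) θ := by
  have h1 := Nat.floor_le ha
  have h2 := Nat.lt_floor_add_one a
  by_cases h : θ ∈ Set.Ici (1 - (a - ⌊a⌋₊))
  · rw [Set.indicator_of_mem h, Pi.one_apply, (Nat.floor_eq_iff (n := ⌊a⌋₊ + 1)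
      (add_nonneg ha hθ.1)).2]
    · push_cast; ring
    · have : 1 - (a - ⌊a⌋₊) ≤ θ := h
      have := hθ.2
      push_cast
      constructor <;> linarith
  · rw [Set.indicator_of_notMem h, add_zero, (Nat.floor_eq_iff (add_nonneg ha hθ.1)).2]
    have : θ < 1 - (a - ⌊a⌋₊) := not_le.1 h
    have := hθ.1
    constructor <;> linarith

lemma integrableOn_floor_add {a : ℝ} (ha : 0 ≤ a) :
    IntegrableOn (fun θ : ℝ => ((⌊a + θ⌋₊ : ℕ) : ℝ)) (Set.Ico 0 1) := by
  refine IntegrableOn.congr_fun (f := fun θ =>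
    (⌊a⌋₊ : ℝ) + (Set.Ici (1 - (a - ⌊a⌋₊))).indicator (1 : ℝ → ℝ) θ) ?_
    (fun θ hθ => (Nat.floor_add_eq_indicator ha hθ).symm) measurableSet_Ico
  exact (integrable_const _).add ((integrable_const (1 : ℝ)).indicator measurableSet_Ici)

/-- Rounding with a uniformly distributed shift preserves the mean. -/
lemma integral_floor_add {a : ℝ} (ha : 0 ≤ a) :
    ∫ θ in Set.Ico (0 : ℝ) 1, ((⌊a + θ⌋₊ : ℕ) : ℝ) = a := by
  rw [setIntegral_congr_fun measurableSet_Ico fun θ hθ => Nat.floor_add_eq_indicator ha hθ,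
    integral_add (integrable_const _)
      (Integrable.indicator (f := 1) (integrable_const (1 : ℝ)) measurableSet_Ici),
    integral_indicator_one measurableSet_Ici, measureReal_restrict_apply measurableSet_Ici]
  have h1 := Nat.floor_le ha
  have h2 := Nat.lt_floor_add_one a
  have : Set.Ici (1 - (a - ⌊a⌋₊)) ∩ Set.Ico (0 : ℝ) 1 = Set.Ico (1 - (a - ⌊a⌋₊)) 1 := by
    ext θ
    simp only [Set.mem_inter_iff, Set.mem_Ici, Set.mem_Ico]
    constructor
    · exact fun h => ⟨h.1, h.2.2⟩
    · exact fun h => ⟨h.1, by linarith [h.1], h.2⟩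
  rw [this, Real.volume_real_Ico_of_le (by linarith)]
  simp

variable {P : Type*} [Fintype P] [PartialOrder P]

/-- Rounding ⌊x + θ⌋ with a common shift θ preserves order and integral bounds. The average over θ
is x, and a closed convex set contains the averages of its points. -/
theorem isLatticePolytope_boundedOrderPolytope (lo hi : P → ℕ) :
    IsLatticePolytope (boundedOrderPolytope lo hi) := by
  refine ⟨((Fintype.piFinset fun p => Finset.Icc (lo p) (hi p)).filter Monotone).image
    fun x p => (x p : ℝ), ?_, ?_⟩
  · intro v hv
    obtain ⟨x, -, rfl⟩ := Finset.mem_image.1 hv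
    exact fun p => ⟨(x p : ℤ), by simp⟩
  refine Set.Subset.antisymm (fun x hx => ?_) (convexHull_min ?_ (convex_boundedOrderPolytope _ _))
  · have hx0 : ∀ p, 0 ≤ x p := fun p => (Nat.cast_nonneg _).trans (hx.2 p).1
    have hint : ∀ p, Integrable (fun θ : ℝ => ((⌊x p + θ⌋₊ : ℕ) : ℝ))
        (volume.restrict (Set.Ico 0 1)) := fun p => integrableOn_floor_add (hx0 p)
    have hprob : IsProbabilityMeasure (volume.restrict (Set.Ico (0 : ℝ) 1)) := ⟨by simp⟩
    have hxint : x = ∫ θ in Set.Ico (0 : ℝ) 1, fun p => ((⌊x p + θ⌋₊ : ℕ) : ℝ) := by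
      funext p
      rw [eval_integral hint, integral_floor_add (hx0 p)]
    rw [hxint]
    refine (convex_convexHull ℝ _).integral_mem
      ((Finset.finite_toSet _).isClosed_convexHull ℝ) ?_ (Integrable.of_eval hint)
    refine (ae_restrict_iff' measurableSet_Ico).2 (Filter.Eventually.of_forall fun θ hθ => ?_)
    refine subset_convexHull ℝ _ (Finset.mem_coe.2 (Finset.mem_image.2
      ⟨fun p => ⌊x p + θ⌋₊, Finset.mem_filter.2 ⟨Fintype.mem_piFinset.2 fun p =>
        Finset.mem_Icc.2 ⟨Nat.le_floor ?_, ?_⟩, fun p q hpq => ?_⟩, rfl⟩))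
    · linarith [(hx.2 p).1, hθ.1]
    · refine Nat.lt_succ_iff.1 ((Nat.floor_lt (add_nonneg (hx0 p) hθ.1)).2 ?_)
      push_cast
      linarith [(hx.2 p).2, hθ.2]
    · exact Nat.floor_le_floor (by linarith [hx.1 hpq])
  · intro v hv
    obtain ⟨x, hx, rfl⟩ := Finset.mem_image.1 (Finset.mem_coe.1 hv)
    obtain ⟨h1, h2⟩ := Finset.mem_filter.1 hx
    refine ⟨fun p q hpq => Nat.cast_le.2 (h2 hpq), fun p => ?_⟩
    have := Finset.mem_Icc.1 (Fintype.mem_piFinset.1 h1 p)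
    exact ⟨Nat.cast_le.2 this.1, Nat.cast_le.2 this.2⟩

lemma ncard_dilate_boundedOrderPolytope {lo hi : P → ℕ} (hhi : Monotone hi) (hle : lo ≤ hi)
    (n : ℕ) : (dilate n (boundedOrderPolytope lo hi) ∩ integerLattice P).ncard =
      ((Fintype.piFinset fun p => Finset.Icc (n * lo p) (n * hi p)).filter Monotone).card := by
  have himage : dilate n (boundedOrderPolytope lo hi) ∩ integerLattice P =
      (fun (x : P → ℕ) p => (x p : ℝ)) ''
        ((Fintype.piFinset fun p => Finset.Icc (n * lo p) (n * hi p)).filter Monotone :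
          Finset (P → ℕ)) := by
    ext y
    simp only [Set.mem_inter_iff, Set.mem_image, Finset.mem_coe, Finset.mem_filter,
      Fintype.mem_piFinset, Finset.mem_Icc, dilate]
    constructor
    · rintro ⟨⟨x, hx, rfl⟩, hint⟩
      choose a ha using hint
      have hb : ∀ p, ((n * lo p : ℕ) : ℝ) ≤ a p ∧ (a p : ℝ) ≤ ((n * hi p : ℕ) : ℝ) := fun p => by
        rw [← ha p]
        push_cast
        exact ⟨mul_le_mul_of_nonneg_left (hx.2 p).1 (Nat.cast_nonneg n),
          mul_le_mul_of_nonneg_left (hx.2 p).2 (Nat.cast_nonneg n)⟩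
      have hb' : ∀ p, ((n * lo p : ℕ) : ℤ) ≤ a p ∧ a p ≤ ((n * hi p : ℕ) : ℤ) := fun p =>
        ⟨by exact_mod_cast (hb p).1, by exact_mod_cast (hb p).2⟩
      have ha0 : ∀ p, 0 ≤ a p := fun p => (Int.natCast_nonneg _).trans (hb' p).1
      refine ⟨fun p => (a p).toNat, ⟨fun p => ?_, fun p q hpq => ?_⟩, funext fun p => ?_⟩
      · have := hb' p
        have := ha0 p
        dsimp only
        omega
      · have h := mul_le_mul_of_nonneg_left (hx.1 hpq) (Nat.cast_nonneg (α := ℝ) n)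
        have hp := ha p
        have hq := ha q
        simp only [Pi.smul_apply, smul_eq_mul] at hp hq
        rw [hp, hq] at h
        exact Int.toNat_le_toNat (by exact_mod_cast h)
      · rw [ha p]
        have h : (((a p).toNat : ℤ) : ℝ) = (a p : ℝ) := by rw [Int.toNat_of_nonneg (ha0 p)]
        exact_mod_cast h
    · rintro ⟨x, ⟨hx, hmono⟩, rfl⟩
      refine ⟨?_, fun p => ⟨(x p : ℤ), by simp⟩⟩
      -- For n = 0 division by n is unavailable; any point of the polytope will do, and `hi` is one.
      rcases n.eq_zero_or_pos with rfl | hn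
      · refine ⟨fun p => (hi p : ℝ), ⟨fun p q hpq => Nat.cast_le.2 (hhi hpq),
          fun p => ⟨Nat.cast_le.2 (hle p), le_rfl⟩⟩, funext fun p => ?_⟩
        have := hx p
        have : x p = 0 := by omega
        simp [this]
      · have hn' : (0 : ℝ) < n := Nat.cast_pos.2 hn
        refine ⟨fun p => (x p : ℝ) / n, ⟨fun p q hpq => ?_, fun p => ⟨?_, ?_⟩⟩,
          funext fun p => ?_⟩
        · exact div_le_div_of_nonneg_right (Nat.cast_le.2 (hmono hpq)) hn'.le
        · rw [le_div_iff₀ hn', mul_comm]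
          exact_mod_cast (hx p).1
        · rw [div_le_iff₀ hn', mul_comm]
          exact_mod_cast (hx p).2
        · simp only [Pi.smul_apply, smul_eq_mul]
          field_simp
  rw [himage, Set.ncard_image_of_injective, Set.ncard_coe_finset]
  intro x y hxy
  funext p
  exact Nat.cast_injective (R := ℝ) (congrFun hxy p)

end

/-! ### The Pitman–Stanley polytope -/

lemma Fin.monotone_of_le_of_val_add_one_eq {α : Type*} [Preorder α] {k : ℕ} {f : Fin k → α}
    (h : ∀ i i' : Fin k, (i : ℕ) + 1 = i' → f i ≤ f i') : Monotone f := by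
  cases k with
  | zero => exact fun i => i.elim0
  | succ k => exact Fin.monotone_iff_le_succ.2 fun i => h _ _ (by simp)

lemma monotone_partialSum {k : ℕ} (y : Fin k → ℕ) : Monotone (partialSum y) := fun _ _ h =>
  Finset.sum_le_sum_of_subset (Finset.Iic_subset_Iic.2 h)

lemma pitmanStanley_eq (k m : ℕ) (y z : Fin k → ℕ) :
    pitmanStanley k m y z = boundedOrderPolytope (fun p : Fin k × Fin m => partialSum z p.1)
      (fun p => partialSum y p.1) := by
  ext x
  constructor
  · rintro ⟨h1, h2, h3⟩
    exact ⟨monotone_prod_iff.2 ⟨fun i => Fin.monotone_of_le_of_val_add_one_eq (h2 i),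
      fun j => Fin.monotone_of_le_of_val_add_one_eq fun i i' h => h3 i i' h j⟩,
      fun p => h1 p.1 p.2⟩
  · rintro ⟨h1, h2⟩
    exact ⟨fun i j => h2 (i, j), fun i j j' h => h1 (Prod.mk_le_mk.2
      ⟨le_rfl, Fin.le_def.2 (by omega)⟩), fun i i' h j => h1 (Prod.mk_le_mk.2
      ⟨Fin.le_def.2 (by omega), le_rfl⟩)⟩

theorem mainTheorem5 (k m : ℕ) (hm : 1 ≤ m) (y z : Fin k → ℕ) :
    EhrhartPositive (pitmanStanley k m y z) := by
  rw [pitmanStanley_eq]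
  refine ⟨isLatticePolytope_boundedOrderPolytope _ _, ?_⟩
  set lo : Fin k × Fin m → ℕ := fun p => partialSum z p.1
  set hi : Fin k × Fin m → ℕ := fun p => partialSum y p.1
  have hlo : Monotone lo := fun _ _ h => monotone_partialSum z h.1
  have hhi : Monotone hi := fun _ _ h => monotone_partialSum y h.1
  by_cases hle : lo ≤ hi
  · obtain ⟨Z, hZ, hZ0⟩ := exists_poly_eval_eq_zetaMatrix_pow k m
    obtain ⟨E, hE, hE0⟩ := exists_poly_card_monotone hlo hhi hle Z hZ hZ0
    exact ⟨E, fun n => by rw [ncard_dilate_boundedOrderPolytope hhi hle, hE], hE0⟩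
  -- If the bounds cross somewhere, the polytope is empty and its Ehrhart polynomial is 0, also at n
  -- = 0.
  · have hempty : boundedOrderPolytope lo hi = ∅ := by
      refine Set.eq_empty_of_forall_notMem fun x hx => hle fun p => ?_
      exact_mod_cast (hx.2 p).1.trans (hx.2 p).2
    refine ⟨0, fun n => ?_, fun d => by simp⟩
    simp [hempty, dilate]
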